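/- Let $\beta>0$, let $b\ge 0$, and let $V=\{(v_1,v_2)\in[0,\beta]^2: v_1\ge v_2\}$ be the set of types, $v_1$ being the value of an agent with budget $b$ and $v_2$ the value of her principal. Types are distributed with a joint density $f$ with support $V$, whose marginal densities $f_1,f_2$ (of $v_1$ and $v_2$) are positive and differentiable on $(0,\beta)$; $F_1$ is the distribution function of $v_1$. An outcome is a pair $(a,t)\in[0,1]\times\mathbb{R}$ (allocation probability, payment). For a set $X$ of outcomes and $w\in[0,\beta]$ let $X_b=\{(a,t)\in X:t\le b\}$ and $Ch(X;w)=\{(a,t)\in X: wa-t\ge wa'-t'\ \forall (a',t')\in X\}$. Write $X\rhd_w Y$ if $wa-t\ge wa'-t'$ for all $(a,t)\in X$, $(a',t')\in Y$, with strict inequality for at least one such pair. For $v=(v_1,v_2)\in V$ let $Ch(X;v)=Ch(X;v_2)$ if $Ch(X;v_2)\rhd_{v_1}Ch(X_b;v_1)$, and $Ch(X;v)=Ch(X_b;v_1)$ otherwise. A mechanism is a pair $q:V\to[0,1]$, $p:V\to\mathbb{R}$, with range $R(q,p)=\{(q(v),p(v)):v\in V\}$. It is incentive compatible (IC) if $(q(v),p(v))\in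 Ch(R(q,p);v)$ for every $v\in V$, and individually rational (IR) if $(0,0)\in R(q,p)$. Its expected revenue is $\int_V p(v)f(v)\,dv$ (whenever $pf$ is integrable). A mechanism is optimal if it is IC and IR, has an expected revenue, and no IC and IR mechanism has a larger expected revenue. A mechanism is POST-1 if for some $\kappa_1\in[0,b]$ and all $v \in V$, $(q(v),p(v))=(0,0)$ if $v_1\le\kappa_1$ and $(q(v),p(v))=(1,\kappa_1)$ otherwise. It is POST-2 if for some $\kappa_1,\kappa_2\in[b,\beta]$ with $0<\kappa_1\le\kappa_2$ and all $v \in V$, $(q(v),p(v))$ is $(0,0)$ if $v_1<\kappa_1$, is $\bigl(1,\,b+\kappa_2(1-\tfrac{b}{\kappa_1})\bigr)$ if $v_2>\kappa_2$, and is $\bigl(\tfrac{b}{\kappa_1},\,b\bigr)$ otherwise. Theorem. Suppose that $x\mapsto x(1-F_1(x))$ is strictly concave on $[0,\beta]$, and let $\widetilde\kappa_1$ be its maximizer over $[0,\beta]$. (1) If $b<\widetilde\kappa_1$, then some POST-2 mechanism is optimal. (2) If $b\ge\widetilde\kappa_1$, then some POST-1 mechanism is optimal. -/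

import Mathlib

open MeasureTheory Set

namespace PrincipalAgent

/-- The type space `V` of pairs `(v₁, v₂)`: `v₁` is the agent's value, `v₂` the principal's. -/
def typeSpace (β : ℝ) : Set (ℝ × ℝ) :=
  {v | v.1 ∈ Icc 0 β ∧ v.2 ∈ Icc 0 β ∧ v.2 ≤ v.1}

/-- Payoff at valuation `w` of the outcome `z = (a, t)`: allocation probability `a`, payment `t`. -/
def payoff (w : ℝ) (z : ℝ × ℝ) : ℝ := w * z.1 - z.2

/-- The budget set `X_b`. -/
def budgetSet (b : ℝ) (X : Set (ℝ × ℝ)) : Set (ℝ × ℝ) := {z ∈ X | z.2 ≤ b}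

/-- The choice correspondence `Ch(X; w)` of a single decision maker with valuation `w`. -/
def choice (X : Set (ℝ × ℝ)) (w : ℝ) : Set (ℝ × ℝ) :=
  {z ∈ X | ∀ z' ∈ X, payoff w z' ≤ payoff w z}

/-- The relation `X ⊵_w Y` between sets of outcomes. -/
def WeaklyBetter (w : ℝ) (X Y : Set (ℝ × ℝ)) : Prop :=
  ∀ z ∈ X, ∀ z' ∈ Y, payoff w z' ≤ payoff w z

/-- The relation `X ▷_w Y`: as `⊵_w`, with strict inequality for at least one pair. -/
def StrictlyBetter (w : ℝ) (X Y : Set (ℝ × ℝ)) : Prop :=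
  WeaklyBetter w X Y ∧ ∃ z ∈ X, ∃ z' ∈ Y, payoff w z' < payoff w z

open Classical in
/-- The choice correspondence `Ch(X; v)` of the principal-agent pair of type `v = (v₁, v₂)`,
where the agent has budget `b`. -/
noncomputable def pairChoice (b : ℝ) (X : Set (ℝ × ℝ)) (v : ℝ × ℝ) : Set (ℝ × ℝ) :=
  if StrictlyBetter v.1 (choice X v.2) (choice (budgetSet b X) v.1) then choice X v.2
  else choice (budgetSet b X) v.1

/-- A direct mechanism `(q, p)` on the type space. Only the values on `typeSpace β` matter. -/
structure Mechanism (β : ℝ) where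
  /-- allocation rule -/
  q : ℝ × ℝ → ℝ
  /-- payment rule -/
  p : ℝ × ℝ → ℝ
  q_mem : ∀ v ∈ typeSpace β, q v ∈ Icc (0 : ℝ) 1

namespace Mechanism

variable {β : ℝ}

/-- The set `R(q, p)` of outcomes of the mechanism. -/
def range (M : Mechanism β) : Set (ℝ × ℝ) := (fun v => (M.q v, M.p v)) '' typeSpace β

/-- Incentive compatibility, for agent's budget `b`. -/
def IC (b : ℝ) (M : Mechanism β) : Prop :=
  ∀ v ∈ typeSpace β, (M.q v, M.p v) ∈ pairChoice b M.range v

/-- Individual rationality. -/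
def IR (M : Mechanism β) : Prop := ((0 : ℝ), (0 : ℝ)) ∈ M.range

/-- The expected revenue of the mechanism is well defined under the density `f`. -/
def HasRevenue (f : ℝ × ℝ → ℝ) (M : Mechanism β) : Prop :=
  IntegrableOn (fun v => M.p v * f v) (typeSpace β)

/-- Expected revenue under the density `f`. -/
noncomputable def rev (f : ℝ × ℝ → ℝ) (M : Mechanism β) : ℝ :=
  ∫ v in typeSpace β, M.p v * f v

/-- Optimality: revenue-maximal among the IC and IR mechanisms. -/
def IsOptimal (b : ℝ) (f : ℝ × ℝ → ℝ) (M : Mechanism β) : Prop :=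
  M.IC b ∧ M.IR ∧ M.HasRevenue f ∧
    ∀ M' : Mechanism β, M'.IC b → M'.IR → M'.HasRevenue f → M'.rev f ≤ M.rev f

/-- POST-1 mechanisms. -/
def IsPost1 (b : ℝ) (M : Mechanism β) : Prop :=
  ∃ κ₁ ∈ Icc 0 b, ∀ v ∈ typeSpace β,
    (M.q v, M.p v) = if v.1 ≤ κ₁ then (0, 0) else (1, κ₁)

/-- POST-2 mechanisms. The condition `0 < κ₁`, automatic for `b > 0`, only says that the
fraction `b / κ₁` makes sense. -/
def IsPost2 (b : ℝ) (M : Mechanism β) : Prop :=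
  ∃ κ₁ ∈ Icc b β, ∃ κ₂ ∈ Icc b β, 0 < κ₁ ∧ κ₁ ≤ κ₂ ∧ ∀ v ∈ typeSpace β,
    (M.q v, M.p v) =
      if v.1 < κ₁ then (0, 0)
      else if κ₂ < v.2 then (1, b + κ₂ * (1 - b / κ₁))
      else (b / κ₁, b)

end Mechanism

/-- Density of the agent's value. -/
noncomputable def density₁ (f : ℝ × ℝ → ℝ) (x : ℝ) : ℝ := ∫ y, f (x, y)

/-- Density of the principal's value. -/
noncomputable def density₂ (f : ℝ × ℝ → ℝ) (y : ℝ) : ℝ := ∫ x, f (x, y)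

/-- Distribution function `F₁` of the agent's value. -/
noncomputable def cdf₁ (f : ℝ × ℝ → ℝ) (x : ℝ) : ℝ := ∫ v in {v : ℝ × ℝ | v.1 ≤ x}, f v

/-- `f` is a joint density with support the type space, whose two marginal densities are positive
and differentiable on `(0, β)`. (The agent's marginal density typically vanishes at `0` and the
principal's at `β`, because `v₂ ≤ v₁`.) -/
structure IsPrior (β : ℝ) (f : ℝ × ℝ → ℝ) : Prop where
  nonneg : ∀ v, 0 ≤ f v
  integrable : Integrable f
  integral_eq_one : ∫ v, f v = 1
  support_eq : tsupport f = typeSpace β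
  density₁_pos : ∀ x ∈ Ioo 0 β, 0 < density₁ f x
  density₂_pos : ∀ x ∈ Ioo 0 β, 0 < density₂ f x
  density₁_diff : ∀ x ∈ Ioo 0 β, DifferentiableAt ℝ (density₁ f) x
  density₂_diff : ∀ x ∈ Ioo 0 β, DifferentiableAt ℝ (density₂ f) x

/-- The revenue `x (1 - F₁(x))` of the posted price `x` for an unconstrained agent. -/
noncomputable def postedRevenue₁ (f : ℝ × ℝ → ℝ) (x : ℝ) : ℝ := x * (1 - cdf₁ f x)

end PrincipalAgent

/-! The range of an IC and IR mechanism is a menu `X` with affordable part `Y`. An outcome of the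
mechanism is either optimal for the agent in `Y` or optimal for the principal in `X`. Indirect
utilities are convex, so by the envelope theorem payments are controlled by the demands, that is, by
the right derivatives. Let `κ` be the infimum of the principal values at which some optimal outcome
costs more than `b`. Put `A = (b + U_Y(κ)) / κ`, with `U_Y` the indirect utility of `Y`. Payments
are then almost surely at most the sum of the payments of two monotone rules: one in `v₁`, with
values in `[0, A]` and top payment `b`, and one in `v₂`, with values in `[A, 1]`, which sells only
at prices of at least `κ` (`Mechanism.rev_le_of_threshold`). A monotone rule is a mixture of posted
prices, one for each level of probability, and its top payment is the integral of those prices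
(`lintegral_envelopePayment_le`). So if the agent's posted revenue is at most `c + g x`, the first
rule earns at most `c A + g b`, with `g` acting as a multiplier of the budget. The second earns at
most `(1 - A) R`, with `R` the principal's best posted revenue at prices of at least `κ`. If `b <
k`, with `k` the monopoly price, the line is taken tangent at `b / A`, or flat when `b / A ≥ k`.
Concavity turns the bound into the revenue of a `post₂`, and the best `post₂` exists by compactness.
If `b ≥ k`, the flat line bounds every revenue by the agent's monopoly revenue, because `v₂ ≤ v₁`
makes the principal the weaker buyer; posting `k` attains it. -/

namespace PrincipalAgent

/-! ### Indirect utility of a menu -/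

/-- The menus considered below: they offer the null outcome, allocation probabilities lie in
`[0, 1]`, and payments are nonnegative. -/
structure IsMenu (Y : Set (ℝ × ℝ)) : Prop where
  zero_mem : ((0 : ℝ), (0 : ℝ)) ∈ Y
  alloc : ∀ z ∈ Y, z.1 ∈ Icc (0 : ℝ) 1
  pay : ∀ z ∈ Y, 0 ≤ z.2

/-- Supremum of the payoffs that the menu `Y` offers at valuation `w`. -/
noncomputable def indirectUtility (Y : Set (ℝ × ℝ)) (w : ℝ) : ℝ := sSup (payoff w '' Y)

/-- Right derivative of the indirect utility: the largest allocation demanded at `w`. -/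
noncomputable def demand (Y : Set (ℝ × ℝ)) (w : ℝ) : ℝ :=
  derivWithin (indirectUtility Y) (Ioi w) w

namespace IsMenu

variable {Y : Set (ℝ × ℝ)}

theorem bddAbove (hY : IsMenu Y) (w : ℝ) : BddAbove (payoff w '' Y) := by
  refine ⟨|w|, ?_⟩
  rintro _ ⟨z, hz, rfl⟩
  have h1 := hY.alloc z hz
  have h2 := hY.pay z hz
  have : w * z.1 ≤ |w| * 1 :=
    mul_le_mul (le_abs_self w) h1.2 h1.1 (abs_nonneg w)
  unfold payoff
  linarith

theorem payoff_le (hY : IsMenu Y) {w : ℝ} {z : ℝ × ℝ} (hz : z ∈ Y) :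
    payoff w z ≤ indirectUtility Y w :=
  le_csSup (hY.bddAbove w) ⟨z, hz, rfl⟩

theorem indirectUtility_le (hY : IsMenu Y) {w c : ℝ} (h : ∀ z ∈ Y, payoff w z ≤ c) :
    indirectUtility Y w ≤ c := by
  refine csSup_le ⟨_, _, hY.zero_mem, rfl⟩ ?_
  rintro _ ⟨z, hz, rfl⟩
  exact h z hz

theorem payoff_eq_of_mem_choice (hY : IsMenu Y) {w : ℝ} {z : ℝ × ℝ} (hz : z ∈ choice Y w) :
    payoff w z = indirectUtility Y w :=
  le_antisymm (hY.payoff_le hz.1) (hY.indirectUtility_le hz.2)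

theorem indirectUtility_nonneg (hY : IsMenu Y) (w : ℝ) : 0 ≤ indirectUtility Y w := by
  simpa [payoff] using hY.payoff_le (w := w) hY.zero_mem

theorem indirectUtility_zero (hY : IsMenu Y) : indirectUtility Y 0 = 0 :=
  le_antisymm (hY.indirectUtility_le fun z hz => by simpa [payoff] using hY.pay z hz)
    (hY.indirectUtility_nonneg 0)

theorem convexOn (hY : IsMenu Y) : ConvexOn ℝ univ (indirectUtility Y) := by
  refine ⟨convex_univ, fun x _ y _ s t hs ht hst => hY.indirectUtility_le fun z hz => ?_⟩
  have hx := mul_le_mul_of_nonneg_left (hY.payoff_le (w := x) hz) hs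
  have hy := mul_le_mul_of_nonneg_left (hY.payoff_le (w := y) hz) ht
  have : payoff (s • x + t • y) z = s * payoff x z + t * payoff y z := by
    simp only [payoff, smul_eq_mul]
    linear_combination z.2 * hst
  simp only [smul_eq_mul] at *
  linarith

theorem continuous (hY : IsMenu Y) : Continuous (indirectUtility Y) :=
  continuousOn_univ.1 (hY.convexOn.continuousOn isOpen_univ)

theorem monotone_indirectUtility (hY : IsMenu Y) : Monotone (indirectUtility Y) := fun x y hxy =>
  hY.indirectUtility_le fun z hz => by
    have h1 := hY.payoff_le (w := y) hz
    have h2 := mul_le_mul_of_nonneg_right hxy (hY.alloc z hz).1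
    unfold payoff at *
    linarith

theorem indirectUtility_le_add (hY : IsMenu Y) {x y : ℝ} (hxy : x ≤ y) :
    indirectUtility Y y ≤ indirectUtility Y x + (y - x) :=
  hY.indirectUtility_le fun z hz => by
    have h1 := hY.payoff_le (w := x) hz
    have h2 := mul_le_mul_of_nonneg_left (hY.alloc z hz).2 (sub_nonneg.2 hxy)
    unfold payoff at *
    linarith

theorem hasDerivWithinAt_demand (hY : IsMenu Y) (w : ℝ) :
    HasDerivWithinAt (indirectUtility Y) (demand Y w) (Ioi w) w :=
  hY.convexOn.hasDerivWithinAt_rightDeriv_of_mem_interior (by simp)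

theorem monotone_demand (hY : IsMenu Y) : Monotone (demand Y) := by
  have := hY.convexOn.monotoneOn_rightDeriv
  rwa [interior_univ, monotoneOn_univ] at this

theorem demand_mul_le (hY : IsMenu Y) (w y : ℝ) (h : w ≤ y) :
    demand Y w * (y - w) ≤ indirectUtility Y y - indirectUtility Y w := by
  rcases h.eq_or_lt with rfl | h
  · simp
  have := hY.convexOn.rightDeriv_le_slope_of_mem_interior (x := w) (y := y) (by simp)
    (mem_univ y) h
  rw [slope_def_field, le_div_iff₀ (sub_pos.2 h)] at this
  exact this

/-- A lower bound on the chords to the right of `w` bounds the demand at `w` from below. -/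
theorem le_demand (hY : IsMenu Y) {w c : ℝ}
    (h : ∀ y, w < y → c * (y - w) ≤ indirectUtility Y y - indirectUtility Y w) :
    c ≤ demand Y w := by
  have h1 := (hasDerivWithinAt_iff_tendsto_slope' (by simp)).1 (hY.hasDerivWithinAt_demand w)
  refine ge_of_tendsto h1 ?_
  filter_upwards [self_mem_nhdsWithin] with y hy
  rw [slope_def_field, le_div_iff₀ (sub_pos.2 hy)]
  exact h y hy

theorem demand_le (hY : IsMenu Y) {w c : ℝ}
    (h : ∀ y, w < y → indirectUtility Y y - indirectUtility Y w ≤ c * (y - w)) :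
    demand Y w ≤ c := by
  have h1 := (hasDerivWithinAt_iff_tendsto_slope' (by simp)).1 (hY.hasDerivWithinAt_demand w)
  refine le_of_tendsto h1 ?_
  filter_upwards [self_mem_nhdsWithin] with y hy
  rw [slope_def_field, div_le_iff₀ (sub_pos.2 hy)]
  exact h y hy

theorem demand_nonneg (hY : IsMenu Y) (w : ℝ) : 0 ≤ demand Y w :=
  hY.le_demand fun y hy => by
    have := hY.monotone_indirectUtility hy.le
    linarith

theorem demand_le_one (hY : IsMenu Y) (w : ℝ) : demand Y w ≤ 1 :=
  hY.demand_le fun y hy => by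
    have := hY.indirectUtility_le_add hy.le
    linarith

/-- The payoff of an optimal outcome is an affine function that supports the indirect utility at
`w`, so its slope is at most the right derivative. This holds however ties are broken. -/
theorem le_demand_of_mem_choice (hY : IsMenu Y) {w : ℝ} {z : ℝ × ℝ} (hz : z ∈ choice Y w) :
    z.1 ≤ demand Y w :=
  hY.le_demand fun y _ => by
    have h1 := hY.payoff_le (w := y) hz.1
    have h2 := hY.payoff_eq_of_mem_choice hz
    unfold payoff at *
    linarith

theorem pay_le_of_mem_choice (hY : IsMenu Y) {w : ℝ} (hw : 0 ≤ w) {z : ℝ × ℝ}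
    (hz : z ∈ choice Y w) :
    z.2 ≤ w * demand Y w - indirectUtility Y w := by
  have h1 := mul_le_mul_of_nonneg_left (hY.le_demand_of_mem_choice hz) hw
  have h2 := hY.payoff_eq_of_mem_choice hz
  unfold payoff at *
  linarith

theorem mul_demand_le (hY : IsMenu Y) {b w : ℝ} (hb : ∀ z ∈ Y, z.2 ≤ b) (hw : 0 ≤ w) :
    w * demand Y w ≤ indirectUtility Y w + b := by
  rcases hw.eq_or_lt with rfl | hw
  · have := hb _ hY.zero_mem
    simp [hY.indirectUtility_zero]
    simpa using this
  rw [mul_comm, ← le_div_iff₀ hw]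
  refine hY.demand_le fun y hy => ?_
  rw [div_mul_eq_mul_div, le_div_iff₀ hw]
  -- Extrapolation from `w` to `y`: `payoff y z = (y / w) * payoff w z + ((y - w) / w) * z.2`, where
  -- both terms are bounded.
  have : indirectUtility Y y ≤ (y * indirectUtility Y w + (y - w) * b) / w := by
    refine hY.indirectUtility_le fun z hz => ?_
    rw [le_div_iff₀ hw]
    have h1 := mul_le_mul_of_nonneg_left (hY.payoff_le (w := w) hz) (hw.le.trans hy.le)
    have h2 := mul_le_mul_of_nonneg_left (hb z hz) (sub_nonneg.2 hy.le)
    unfold payoff at *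
    linarith
  rw [le_div_iff₀ hw] at this
  linarith

theorem integral_demand (hY : IsMenu Y) (x y : ℝ) :
    ∫ w in x..y, demand Y w = indirectUtility Y y - indirectUtility Y x :=
  intervalIntegral.integral_eq_sub_of_hasDeriv_right hY.continuous.continuousOn
    (fun w _ => hY.hasDerivWithinAt_demand w) hY.monotone_demand.intervalIntegrable

end IsMenu

/-! ### Revenue of a monotone allocation rule -/

/-- The payment `w a(w) - ∫₀ʷ a` that implements the allocation rule `a`. -/
noncomputable def envelopePayment (a : ℝ → ℝ) (w : ℝ) : ℝ := ∫ y in (0 : ℝ)..w, (a w - a y)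

/-- Truncating at zero kills the integrand above `w`, so the domain of integration no longer depends
on `w` and Tonelli applies. -/
theorem ofReal_envelopePayment {a : ℝ → ℝ} (ha : Monotone a) {β w : ℝ} (hw : w ∈ Icc 0 β) :
    ENNReal.ofReal (envelopePayment a w) = ∫⁻ y in Ioc 0 β, ENNReal.ofReal (a w - a y) := by
  have hInt : IntervalIntegrable (fun y => a w - a y) volume 0 w :=
    intervalIntegrable_const.sub ha.intervalIntegrable
  rw [envelopePayment, intervalIntegral.integral_of_le hw.1,
    ofReal_integral_eq_lintegral_ofReal ((intervalIntegrable_iff_integrableOn_Ioc_of_le hw.1).1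
      hInt)
      ((ae_restrict_iff' measurableSet_Ioc).2 (ae_of_all _ fun y hy => sub_nonneg.2 (ha hy.2))),
    ← Ioc_union_Ioc_eq_Ioc hw.1 hw.2,
    lintegral_union measurableSet_Ioc (Ioc_disjoint_Ioc_of_le le_rfl)]
  have : ∫⁻ y in Ioc w β, ENNReal.ofReal (a w - a y) = ∫⁻ y in Ioc w β, 0 :=
    setLIntegral_congr_fun measurableSet_Ioc fun y hy =>
      ENNReal.ofReal_of_nonpos (sub_nonpos.2 (ha hy.1.le))
  rw [this]
  simp

theorem envelopePayment_nonneg {a : ℝ → ℝ} (ha : Monotone a) {w : ℝ} (hw : 0 ≤ w) :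
    0 ≤ envelopePayment a w :=
  intervalIntegral.integral_nonneg hw fun _ hy => sub_nonneg.2 (ha hy.2)

theorem envelopePayment_eq {a : ℝ → ℝ} (ha : Monotone a) (w : ℝ) :
    envelopePayment a w = w * a w - ∫ y in (0 : ℝ)..w, a y := by
  rw [envelopePayment, intervalIntegral.integral_sub intervalIntegrable_const
    ha.intervalIntegrable]
  simp

theorem measurable_envelopePayment {a : ℝ → ℝ} (ha : Monotone a) :
    Measurable (envelopePayment a) := by
  have : envelopePayment a = fun w => w * a w - ∫ y in (0 : ℝ)..w, a y :=
    funext (envelopePayment_eq ha)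
  rw [this]
  have hc : Continuous fun w => ∫ y in (0 : ℝ)..w, a y :=
    intervalIntegral.continuous_primitive (fun _ _ => ha.intervalIntegrable) 0
  exact (measurable_id.mul ha.measurable).sub hc.measurable

/-- If the revenue of every posted price `x ≥ κ` is at most `c + g x`, then the revenue of a
monotone allocation rule that rises from `A₀` to `A₁` above `κ` is at most `c (A₁ - A₀)` plus `g`
times the highest payment. -/
theorem lintegral_envelopePayment_le {a : ℝ → ℝ} (ha : Monotone a) {β κ A₀ A₁ : ℝ}
    (hA : ∀ y ∈ Icc 0 β, a y ∈ Icc A₀ A₁) (hκ : ∀ y ∈ Ioo 0 κ, a y ≤ A₀) (hκβ : κ ≤ β)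
    (ν : Measure ℝ) [SFinite ν] {c g : ENNReal}
    (hν : ∀ x ∈ Icc 0 β, κ ≤ x → ENNReal.ofReal x * ν (Icc x β) ≤ c + g * ENNReal.ofReal x) :
    ∫⁻ w in Icc 0 β, ENNReal.ofReal (envelopePayment a w) ∂ν ≤
      c * ENNReal.ofReal (A₁ - A₀) + g * ∫⁻ y in Ioc 0 β, ENNReal.ofReal (A₁ - a y) := by
  have hm := ha.measurable
  have hkey : ∀ y ∈ Ioc 0 β, ∀ s ≤ A₁, ENNReal.ofReal (s - a y) =
      ∫⁻ α in Ico A₀ A₁, (if a y ≤ α then 1 else 0) * (if α < s then 1 else 0) := by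
    intro y hy s hs
    have hy' := hA y ⟨hy.1.le, hy.2⟩
    have : (fun α => (if a y ≤ α then (1 : ENNReal) else 0) * (if α < s then 1 else 0)) =
        (Ico (a y) s).indicator 1 := by
      ext α
      by_cases h1 : a y ≤ α <;> by_cases h2 : α < s <;> simp [h1, h2]
    rw [this, lintegral_indicator_one measurableSet_Ico, Measure.restrict_apply measurableSet_Ico,
      Ico_inter_Ico, sup_eq_left.2 hy'.1, inf_eq_left.2 hs, Real.volume_Ico]
  have hm1 : Measurable fun q : ℝ × ℝ => if a q.1 ≤ q.2 then (1 : ENNReal) else 0 :=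
    Measurable.ite (measurableSet_le (hm.comp measurable_fst) measurable_snd)
      measurable_const measurable_const
  have hm2 : Measurable fun q : ℝ × ℝ => if q.2 < a q.1 then (1 : ENNReal) else 0 :=
    Measurable.ite (measurableSet_lt measurable_snd (hm.comp measurable_fst))
      measurable_const measurable_const
  -- `X α` is the price of the probability unit at level `α`, and `N α` is the mass of types that
  -- buy it.
  set X : ℝ → ENNReal := fun α => ∫⁻ y in Ioc 0 β, if a y ≤ α then 1 else 0 with hX
  set N : ℝ → ENNReal := fun α => ∫⁻ w in Icc 0 β, (if α < a w then 1 else 0) ∂ν with hN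
  have hXm : Measurable X := hm1.lintegral_prod_left'
  have hcost : ∀ s : ℝ → ENNReal, Measurable s →
      ∫⁻ y in Ioc 0 β, ∫⁻ α in Ico A₀ A₁, (if a y ≤ α then 1 else 0) * s α =
        ∫⁻ α in Ico A₀ A₁, X α * s α := by
    intro s hs
    rw [lintegral_lintegral_swap (hm1.mul (hs.comp measurable_snd)).aemeasurable]
    refine lintegral_congr fun α => ?_
    exact lintegral_mul_const _ (hm1.comp (measurable_id.prodMk measurable_const))
  have hL : ∫⁻ w in Icc 0 β, ENNReal.ofReal (envelopePayment a w) ∂ν =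
      ∫⁻ α in Ico A₀ A₁, X α * N α := by
    have : ∀ w ∈ Icc 0 β, ENNReal.ofReal (envelopePayment a w) =
        ∫⁻ α in Ico A₀ A₁, X α * (if α < a w then 1 else 0) := by
      intro w hw
      rw [ofReal_envelopePayment ha hw, ← hcost _ (Measurable.ite measurableSet_Iio
        measurable_const measurable_const)]
      exact setLIntegral_congr_fun measurableSet_Ioc fun y hy => hkey y hy _ (hA w hw).2
    rw [setLIntegral_congr_fun measurableSet_Icc this, lintegral_lintegral_swap]
    · refine lintegral_congr fun α => ?_
      exact lintegral_const_mul _ (hm2.comp (measurable_id.prodMk measurable_const))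
    · exact ((hXm.comp measurable_snd).mul hm2).aemeasurable
  have hR : ∫⁻ y in Ioc 0 β, ENNReal.ofReal (A₁ - a y) = ∫⁻ α in Ico A₀ A₁, X α := by
    rw [setLIntegral_congr_fun measurableSet_Ioc fun y hy => hkey y hy A₁ le_rfl,
      hcost _ (Measurable.ite measurableSet_Iio measurable_const measurable_const)]
    exact setLIntegral_congr_fun measurableSet_Ico fun α hα => by simp [hα.2]
  have hXvol : ∀ α, X α = volume (Ioc 0 β ∩ {y | a y ≤ α}) := by
    intro α
    have hs : MeasurableSet {y | a y ≤ α} := measurableSet_le hm measurable_const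
    have : (fun y => if a y ≤ α then (1 : ENNReal) else 0) = {y | a y ≤ α}.indicator 1 := by
      ext y; simp [indicator_apply]
    rw [hX]; simp only
    rw [this, lintegral_indicator_one hs, Measure.restrict_apply hs, inter_comm]
  have hNvol : ∀ α, N α = ν (Icc 0 β ∩ {w | α < a w}) := by
    intro α
    have hs : MeasurableSet {w | α < a w} := measurableSet_lt measurable_const hm
    have : (fun w => if α < a w then (1 : ENNReal) else 0) = {w | α < a w}.indicator 1 := by
      ext y; simp [indicator_apply]
    rw [hN]; simp only
    rw [this, lintegral_indicator_one hs, Measure.restrict_apply hs, inter_comm]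
  -- Each level is sold like a good with posted price `X α`. That price is at least `κ`, since the
  -- rule stays at or below `A₀ ≤ α` before `κ`.
  have hpt : ∀ α ∈ Ico A₀ A₁, X α * N α ≤ c + g * X α := by
    intro α hα
    rcases (Icc 0 β ∩ {w | α < a w}).eq_empty_or_nonempty with he | ⟨w₀, hw₀, -⟩
    · rw [hNvol, he]; simp
    have hβ : 0 ≤ β := hw₀.1.trans hw₀.2
    have hle : X α ≤ ENNReal.ofReal β := by
      rw [hXvol]
      exact (measure_mono inter_subset_left).trans (by simp [Real.volume_Ioc])
    have hge : ENNReal.ofReal κ ≤ X α := by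
      rw [hXvol]
      refine le_trans ?_ (measure_mono (s := Ioo 0 κ) fun y hy =>
        ⟨⟨hy.1, hy.2.le.trans hκβ⟩, (hκ y hy).trans hα.1⟩)
      simp [Real.volume_Ioo]
    have htop : X α ≠ ⊤ := ne_top_of_le_ne_top ENNReal.ofReal_ne_top hle
    obtain ⟨x, hx0, hx⟩ : ∃ x : ℝ, 0 ≤ x ∧ X α = ENNReal.ofReal x :=
      ⟨(X α).toReal, ENNReal.toReal_nonneg, (ENNReal.ofReal_toReal htop).symm⟩
    rw [hx] at hle hge ⊢
    rw [ENNReal.ofReal_le_ofReal_iff hβ] at hle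
    rw [ENNReal.ofReal_le_ofReal_iff hx0] at hge
    refine le_trans ?_ (hν x ⟨hx0, hle⟩ hge)
    gcongr
    rw [hNvol]
    -- A buyer `w` of level `α` has value at least `X α`: by monotonicity, every `y` with `a y ≤ α`
    -- lies below `w`.
    refine measure_mono fun w hw => ⟨?_, hw.1.2⟩
    rw [← ENNReal.ofReal_le_ofReal_iff hw.1.1, ← hx, hXvol]
    refine (measure_mono (t := Ioc 0 w) fun y hy => ⟨hy.1.1, ?_⟩).trans (by simp [Real.volume_Ioc])
    by_contra hlt
    exact absurd (ha (not_le.1 hlt).le) (not_le.2 (lt_of_le_of_lt hy.2 hw.2))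
  rw [hL, hR]
  calc ∫⁻ α in Ico A₀ A₁, X α * N α ≤ ∫⁻ α in Ico A₀ A₁, (c + g * X α) :=
        setLIntegral_mono (measurable_const.add (hXm.const_mul g)) hpt
    _ = _ := by
        rw [lintegral_add_left measurable_const, lintegral_const_mul _ hXm]
        simp [Real.volume_Ico]

/-! ### Marginal distributions -/

/-- Mass that the density `f` gives to the types with `φ v ≥ x`. -/
noncomputable def tail (f : ℝ × ℝ → ℝ) (φ : ℝ × ℝ → ℝ) (x : ℝ) : ℝ := ∫ v in {v | x ≤ φ v}, f v

/-- Distribution of `φ` under the density `f`. -/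
noncomputable def law (f : ℝ × ℝ → ℝ) (φ : ℝ × ℝ → ℝ) : Measure ℝ :=
  (volume.withDensity fun v => ENNReal.ofReal (f v)).map φ

theorem measurableSet_typeSpace (β : ℝ) : MeasurableSet (typeSpace β) :=
  (measurable_fst measurableSet_Icc).inter
    ((measurable_snd measurableSet_Icc).inter (measurableSet_le measurable_snd measurable_fst))

theorem ae_fst_ne (x : ℝ) : ∀ᵐ v : ℝ × ℝ, v.1 ≠ x :=
  Measure.quasiMeasurePreserving_fst.ae (Measure.ae_ne volume x)

theorem ae_snd_ne (x : ℝ) : ∀ᵐ v : ℝ × ℝ, v.2 ≠ x :=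
  Measure.quasiMeasurePreserving_snd.ae (Measure.ae_ne volume x)

theorem setIntegral_gt_eq_tail {f φ : ℝ × ℝ → ℝ} (hne : ∀ x, ∀ᵐ v : ℝ × ℝ, φ v ≠ x) (x : ℝ) :
    ∫ v in {v | x < φ v}, f v = tail f φ x := by
  refine setIntegral_congr_set ?_
  filter_upwards [hne x] with v hv
  exact propext ⟨le_of_lt, fun h => lt_of_le_of_ne h (Ne.symm hv)⟩

namespace IsPrior

variable {β : ℝ} {f : ℝ × ℝ → ℝ}

theorem aemeasurable_ofReal (hf : IsPrior β f) : AEMeasurable (fun v => ENNReal.ofReal (f v)) :=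
  hf.integrable.aemeasurable.ennreal_ofReal

theorem eq_zero_of_notMem (hf : IsPrior β f) {v : ℝ × ℝ} (hv : v ∉ typeSpace β) : f v = 0 :=
  image_eq_zero_of_notMem_tsupport (by rwa [hf.support_eq])

theorem isFiniteMeasure_law (hf : IsPrior β f) (φ : ℝ × ℝ → ℝ) : IsFiniteMeasure (law f φ) := by
  have := isFiniteMeasure_withDensity_ofReal hf.integrable.hasFiniteIntegral
  unfold law
  infer_instance

theorem tail_nonneg (hf : IsPrior β f) (φ : ℝ × ℝ → ℝ) (x : ℝ) : 0 ≤ tail f φ x :=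
  integral_nonneg fun v => hf.nonneg v

theorem tail_le_one (hf : IsPrior β f) (φ : ℝ × ℝ → ℝ) (x : ℝ) : tail f φ x ≤ 1 := by
  rw [← hf.integral_eq_one]
  exact setIntegral_le_integral hf.integrable (ae_of_all _ hf.nonneg)

theorem tail_snd_le_tail_fst (hf : IsPrior β f) (x : ℝ) :
    tail f Prod.snd x ≤ tail f Prod.fst x := by
  unfold tail
  rw [← integral_indicator (measurableSet_le measurable_const measurable_snd),
    ← integral_indicator (measurableSet_le measurable_const measurable_fst)]
  refine integral_mono
    (hf.integrable.indicator (measurableSet_le measurable_const measurable_snd))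
    (hf.integrable.indicator (measurableSet_le measurable_const measurable_fst)) fun v => ?_
  by_cases hv : v ∈ typeSpace β
  · by_cases h2 : x ≤ v.2
    · simp [h2, h2.trans hv.2.2]
    · simpa [h2] using indicator_nonneg (fun v _ => hf.nonneg v) v
  · simp [indicator_apply, hf.eq_zero_of_notMem hv]

theorem law_Icc_le (hf : IsPrior β f) {φ : ℝ × ℝ → ℝ} (hφ : Measurable φ) (x : ℝ) :
    law f φ (Icc x β) ≤ ENNReal.ofReal (tail f φ x) := by
  rw [law, Measure.map_apply hφ measurableSet_Icc,
    withDensity_apply _ (hφ measurableSet_Icc), tail,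
    ofReal_integral_eq_lintegral_ofReal hf.integrable.integrableOn (ae_of_all _ hf.nonneg)]
  exact lintegral_mono_set fun v hv => hv.1

theorem lintegral_comp_mul_le (hf : IsPrior β f) {φ : ℝ × ℝ → ℝ} (hφ : Measurable φ)
    (hφV : ∀ v ∈ typeSpace β, φ v ∈ Icc 0 β) {h : ℝ → ENNReal} (hh : Measurable h) :
    ∫⁻ v in typeSpace β, h (φ v) * ENNReal.ofReal (f v) ≤ ∫⁻ w in Icc 0 β, h w ∂(law f φ) := by
  rw [law, setLIntegral_map measurableSet_Icc hh hφ,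
    setLIntegral_withDensity_eq_lintegral_mul₀ (g := fun v => h (φ v)) hf.aemeasurable_ofReal
      (hh.comp hφ).aemeasurable (hφ measurableSet_Icc)]
  refine (lintegral_mono_set (t := φ ⁻¹' Icc 0 β) hφV).trans (le_of_eq ?_)
  simp [mul_comm]

/-- Dominated convergence: off the null set `φ = x`, the indicator is locally constant in the
threshold near `x`. -/
theorem continuous_tail (hf : IsPrior β f) {φ : ℝ × ℝ → ℝ} (hφ : Measurable φ)
    (hne : ∀ x, ∀ᵐ v : ℝ × ℝ, φ v ≠ x) : Continuous (tail f φ) := by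
  have hS : ∀ x, MeasurableSet {v | x ≤ φ v} := fun x => measurableSet_le measurable_const hφ
  have : tail f φ = fun x => ∫ v, {v | x ≤ φ v}.indicator f v :=
    funext fun x => (integral_indicator (hS x)).symm
  rw [this, continuous_iff_continuousAt]
  intro x
  refine continuousAt_of_dominated (bound := fun v => ‖f v‖)
    (Filter.Eventually.of_forall fun y => (hf.integrable.indicator (hS y)).1)
    (Filter.Eventually.of_forall fun y => ae_of_all _ fun v => norm_indicator_le_norm_self _ _)
    hf.integrable.norm ?_
  filter_upwards [hne x] with v hv
  rcases hv.lt_or_gt with h | h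
  · refine (continuousAt_const (y := (0 : ℝ))).congr ?_
    filter_upwards [Ioi_mem_nhds h] with y hy
    simp [not_le.2 (mem_Ioi.1 hy)]
  · refine (continuousAt_const (y := f v)).congr ?_
    filter_upwards [Iio_mem_nhds h] with y hy
    simp [(mem_Iio.1 hy).le]

theorem continuous_tail_fst (hf : IsPrior β f) : Continuous (tail f Prod.fst) :=
  hf.continuous_tail measurable_fst ae_fst_ne

theorem continuous_tail_snd (hf : IsPrior β f) : Continuous (tail f Prod.snd) :=
  hf.continuous_tail measurable_snd ae_snd_ne

theorem postedRevenue₁_eq (hf : IsPrior β f) (x : ℝ) :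
    postedRevenue₁ f x = x * tail f Prod.fst x := by
  have h1 : MeasurableSet {v : ℝ × ℝ | v.1 ≤ x} := measurableSet_le measurable_fst measurable_const
  have h := integral_add_compl h1 hf.integrable
  have h2 : {v : ℝ × ℝ | v.1 ≤ x}ᶜ = {v | x < v.1} := by
    ext v; simp
  rw [h2, setIntegral_gt_eq_tail ae_fst_ne, hf.integral_eq_one] at h
  rw [postedRevenue₁, cdf₁, ← h]
  ring

/-- Upper bound on the revenue of a mechanism whose payments are dominated by the sum of payments
of two monotone allocation rules, one in the agent's and one in the principal's value. -/
theorem rev_le (hf : IsPrior β f) {M : Mechanism β} (hrev : M.HasRevenue f)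
    (hpos : ∀ v ∈ typeSpace β, 0 ≤ M.p v)
    {a₁ a₂ : ℝ → ℝ} (h₁ : Monotone a₁) (h₂ : Monotone a₂) {A κ T R : ℝ} (hκβ : κ ≤ β)
    (hA₁ : ∀ y ∈ Icc 0 β, a₁ y ∈ Icc 0 A) (hA₂ : ∀ y ∈ Icc 0 β, a₂ y ∈ Icc A 1)
    (hκ : ∀ y ∈ Ioo 0 κ, a₂ y ≤ A) (hT : ∫ y in (0 : ℝ)..β, (A - a₁ y) ≤ T)
    (hp : ∀ᵐ v : ℝ × ℝ, v ∈ typeSpace β →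
      M.p v ≤ envelopePayment a₁ v.1 + envelopePayment a₂ v.2)
    (hR : ∀ x ∈ Icc 0 β, κ ≤ x → x * tail f Prod.snd x ≤ R) (hR0 : 0 ≤ R)
    (hβ : 0 ≤ β) {c g : ℝ} (hc : 0 ≤ c) (hg : 0 ≤ g)
    (hcg : ∀ x ∈ Icc 0 β, x * tail f Prod.fst x ≤ c + g * x) :
    M.rev f ≤ c * A + g * T + (1 - A) * R := by
  have := hf.isFiniteMeasure_law Prod.fst
  have := hf.isFiniteMeasure_law Prod.snd
  have hA0 : 0 ≤ A := (hA₁ 0 ⟨le_rfl, hβ⟩).1.trans (hA₁ 0 ⟨le_rfl, hβ⟩).2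
  have hA1 : A ≤ 1 := (hA₂ 0 ⟨le_rfl, hβ⟩).1.trans (hA₂ 0 ⟨le_rfl, hβ⟩).2
  have hTint : IntervalIntegrable (fun y => A - a₁ y) volume 0 β :=
    intervalIntegrable_const.sub h₁.intervalIntegrable
  have hT0 : 0 ≤ ∫ y in (0 : ℝ)..β, (A - a₁ y) :=
    intervalIntegral.integral_nonneg hβ fun y hy => sub_nonneg.2 (hA₁ y hy).2
  have hTl : ∫⁻ y in Ioc 0 β, ENNReal.ofReal (A - a₁ y) ≤ ENNReal.ofReal T := by
    rw [← ofReal_integral_eq_lintegral_ofReal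
      ((intervalIntegrable_iff_integrableOn_Ioc_of_le hβ).1 hTint)
      ((ae_restrict_iff' measurableSet_Ioc).2
        (ae_of_all _ fun y hy => sub_nonneg.2 (hA₁ y ⟨hy.1.le, hy.2⟩).2)),
      ← intervalIntegral.integral_of_le hβ]
    exact ENNReal.ofReal_le_ofReal hT
  have hagent := lintegral_envelopePayment_le h₁ hA₁ (κ := 0) (by simp) hβ (law f Prod.fst)
    (c := ENNReal.ofReal c) (g := ENNReal.ofReal g) (fun x hx _ => by
      refine (mul_le_mul_right (hf.law_Icc_le measurable_fst x) _).trans ?_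
      rw [← ENNReal.ofReal_mul hx.1, ← ENNReal.ofReal_mul hg,
        ← ENNReal.ofReal_add hc (mul_nonneg hg hx.1)]
      exact ENNReal.ofReal_le_ofReal (hcg x hx))
  have hprincipal := lintegral_envelopePayment_le h₂ hA₂ hκ hκβ (law f Prod.snd)
    (c := ENNReal.ofReal R) (g := 0) (fun x hx hκx => by
      refine (mul_le_mul_right (hf.law_Icc_le measurable_snd x) _).trans ?_
      rw [← ENNReal.ofReal_mul hx.1, zero_mul, add_zero]
      exact ENNReal.ofReal_le_ofReal (hR x hx hκx))
  have hm₁ := (measurable_envelopePayment h₁).ennreal_ofReal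
  have hm₂ := (measurable_envelopePayment h₂).ennreal_ofReal
  have hlin : ENNReal.ofReal (M.rev f) ≤
      ∫⁻ v in typeSpace β, (ENNReal.ofReal (envelopePayment a₁ v.1) * ENNReal.ofReal (f v) +
        ENNReal.ofReal (envelopePayment a₂ v.2) * ENNReal.ofReal (f v)) := by
    rw [Mechanism.rev, ofReal_integral_eq_lintegral_ofReal hrev
      ((ae_restrict_iff' (measurableSet_typeSpace β)).2
        (ae_of_all _ fun v hv => mul_nonneg (hpos v hv) (hf.nonneg v)))]
    refine setLIntegral_mono_ae' (measurableSet_typeSpace β) ?_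
    filter_upwards [hp] with v hv hvV
    rw [ENNReal.ofReal_mul (hpos v hvV), ← add_mul]
    gcongr
    exact (ENNReal.ofReal_le_ofReal (hv hvV)).trans ENNReal.ofReal_add_le
  replace hlin := hlin.trans_eq (lintegral_add_left'
    ((hm₁.comp measurable_fst).aemeasurable.mul hf.aemeasurable_ofReal.restrict) _)
  have hfin : ENNReal.ofReal (M.rev f) ≤ ENNReal.ofReal (c * A + g * T + (1 - A) * R) := by
    have hT0' := hT0.trans hT
    rw [ENNReal.ofReal_add (by positivity) (mul_nonneg (sub_nonneg.2 hA1) hR0),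
      ENNReal.ofReal_add (by positivity) (by positivity), ENNReal.ofReal_mul hc,
      ENNReal.ofReal_mul hg, mul_comm (1 - A), ENNReal.ofReal_mul hR0]
    refine hlin.trans (add_le_add
      ((hf.lintegral_comp_mul_le measurable_fst (fun v hv => hv.1) hm₁).trans
        (hagent.trans ?_))
      ((hf.lintegral_comp_mul_le measurable_snd (fun v hv => hv.2.1) hm₂).trans
        (hprincipal.trans ?_)))
    · rw [sub_zero]
      gcongr
    · simp
  have hT0' := hT0.trans hT
  exact (ENNReal.ofReal_le_ofReal_iff (add_nonneg (by positivity)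
    (mul_nonneg (sub_nonneg.2 hA1) hR0))).1 hfin

end IsPrior

/-! ### Incentive compatible mechanisms -/

/-- An affordable optimum of the principal is itself available in `X_b`, so it cannot strictly beat
the agent's best choice there. -/
theorem exists_gt_of_strictlyBetter {b w₁ w₂ : ℝ} {X : Set (ℝ × ℝ)}
    (h : StrictlyBetter w₁ (choice X w₂) (choice (budgetSet b X) w₁)) :
    ∃ z ∈ choice X w₂, b < z.2 := by
  obtain ⟨-, z, hz, z', hz', hlt⟩ := h
  refine ⟨z, hz, lt_of_not_ge fun hle => ?_⟩
  exact absurd (hz'.2 z ⟨hz.1, hle⟩) (not_le.2 hlt)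

/-- This dichotomy is all that the revenue bounds need from incentive compatibility. -/
theorem mem_pairChoice_cases {b : ℝ} {X : Set (ℝ × ℝ)} {v z : ℝ × ℝ}
    (h : z ∈ pairChoice b X v) :
    z ∈ choice (budgetSet b X) v.1 ∨ (∃ z' ∈ choice X v.2, b < z'.2) ∧ z ∈ choice X v.2 := by
  unfold pairChoice at h
  split_ifs at h with hs
  · exact Or.inr ⟨exists_gt_of_strictlyBetter hs, h⟩
  · exact Or.inl h

namespace Mechanism

variable {β b : ℝ} {M : Mechanism β}

/-- Payments are nonnegative because the type assigned `(0, 0)` would prefer any outcome with a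
negative price, which is affordable as `0 ≤ b`. -/
theorem isMenu_range (hb : 0 ≤ b) (hIC : M.IC b) (hIR : M.IR) : IsMenu M.range := by
  have halloc : ∀ z ∈ M.range, z.1 ∈ Icc (0 : ℝ) 1 := by
    rintro _ ⟨v, hv, rfl⟩
    exact M.q_mem v hv
  refine ⟨hIR, halloc, fun z hz => ?_⟩
  obtain ⟨v, hv, hv0⟩ := hIR
  have h := hIC v hv
  have hz1 := (halloc z hz).1
  simp only at hv0
  rw [hv0] at h
  by_contra hneg
  rcases mem_pairChoice_cases h with h | ⟨-, h⟩
  · have h1 := h.2 z ⟨hz, (not_le.1 hneg).le.trans hb⟩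
    have h2 := mul_nonneg hv.1.1 hz1
    simp only [payoff] at h1
    linarith
  · have h1 := h.2 z hz
    have h2 := mul_nonneg hv.2.1.1 hz1
    simp only [payoff] at h1
    linarith

theorem isMenu_budgetSet (hb : 0 ≤ b) (hIC : M.IC b) (hIR : M.IR) :
    IsMenu (budgetSet b M.range) :=
  have h := isMenu_range hb hIC hIR
  ⟨⟨h.zero_mem, hb⟩, fun z hz => h.alloc z hz.1, fun z hz => h.pay z hz.1⟩

end Mechanism

theorem IsMenu.envelopePayment_demand {Y : Set (ℝ × ℝ)} (hY : IsMenu Y) (w : ℝ) :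
    envelopePayment (demand Y) w = w * demand Y w - indirectUtility Y w := by
  rw [envelopePayment_eq hY.monotone_demand, hY.integral_demand, hY.indirectUtility_zero, sub_zero]

/-- Allocation rule that follows `a` below `κ` and jumps to `A` at `κ`. -/
noncomputable def capAbove (a : ℝ → ℝ) (κ A w : ℝ) : ℝ := if w < κ then min (a w) A else A

/-- Allocation rule that equals `A` up to `κ` and follows `a` above `κ`. -/
noncomputable def floorBelow (a : ℝ → ℝ) (κ A w : ℝ) : ℝ := if w ≤ κ then A else max A (a w)

section
variable {a : ℝ → ℝ} {κ A : ℝ}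

theorem monotone_capAbove (ha : Monotone a) : Monotone (capAbove a κ A) := by
  intro x y hxy
  unfold capAbove
  split_ifs with h1 h2 h2
  · exact min_le_min_right A (ha hxy)
  · exact min_le_right _ _
  · exact absurd (hxy.trans_lt h2) h1
  · exact le_rfl

theorem monotone_floorBelow (ha : Monotone a) : Monotone (floorBelow a κ A) := by
  intro x y hxy
  unfold floorBelow
  split_ifs with h1 h2 h2
  · exact le_rfl
  · exact le_max_left _ _
  · exact absurd (hxy.trans h2) h1
  · exact max_le_max_left A (ha hxy)

theorem envelopePayment_capAbove_of_lt (hle : ∀ w ∈ Ico 0 κ, a w ≤ A) {w : ℝ}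
    (hw : w ∈ Ico 0 κ) : envelopePayment (capAbove a κ A) w = envelopePayment a w := by
  have h : ∀ y ∈ Ico 0 κ, capAbove a κ A y = a y := fun y hy => by
    simp [capAbove, hy.2, hle y hy]
  refine intervalIntegral.integral_congr fun y hy => ?_
  rw [uIcc_of_le hw.1] at hy
  simp only [h w hw, h y ⟨hy.1, hy.2.trans_lt hw.2⟩]

theorem integral_sub_capAbove (ha : Monotone a) (hle : ∀ w ∈ Ico 0 κ, a w ≤ A) (hκ : 0 ≤ κ)
    {w : ℝ} (hw : κ ≤ w) :
    ∫ y in (0 : ℝ)..w, (A - capAbove a κ A y) = κ * A - ∫ y in (0 : ℝ)..κ, a y := by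
  have hi : ∀ x y : ℝ, IntervalIntegrable (fun y => A - capAbove a κ A y) volume x y :=
    fun x y => intervalIntegrable_const.sub (monotone_capAbove ha).intervalIntegrable
  have h1 : ∫ y in (0 : ℝ)..κ, (A - capAbove a κ A y) = ∫ y in (0 : ℝ)..κ, (A - a y) :=
    intervalIntegral.integral_congr_Ioo_of_le hκ fun y hy => by
      simp [capAbove, hy.2, hle y ⟨hy.1.le, hy.2⟩]
  have h2 : ∫ y in κ..w, (A - capAbove a κ A y) = ∫ y in κ..w, 0 :=
    intervalIntegral.integral_congr_Ioo_of_le hw fun y hy => by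
      simp [capAbove, not_lt.2 hy.1.le]
  rw [← intervalIntegral.integral_add_adjacent_intervals (hi 0 κ) (hi κ w), h1, h2,
    intervalIntegral.integral_sub intervalIntegrable_const ha.intervalIntegrable]
  simp

theorem envelopePayment_capAbove_of_ge (ha : Monotone a) (hle : ∀ w ∈ Ico 0 κ, a w ≤ A)
    (hκ : 0 ≤ κ) {w : ℝ} (hw : κ ≤ w) :
    envelopePayment (capAbove a κ A) w = κ * A - ∫ y in (0 : ℝ)..κ, a y := by
  rw [← integral_sub_capAbove ha hle hκ hw]
  simp [envelopePayment, capAbove, not_lt.2 hw]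

theorem envelopePayment_floorBelow (ha : Monotone a) (hle : ∀ w, κ < w → A ≤ a w) (hκ : 0 ≤ κ)
    {w : ℝ} (hw : κ < w) :
    envelopePayment (floorBelow a κ A) w = w * a w - κ * A - ∫ y in κ..w, a y := by
  have hm := monotone_floorBelow (κ := κ) (A := A) ha
  have h : ∀ y, κ < y → floorBelow a κ A y = a y := fun y hy => by
    simp [floorBelow, not_le.2 hy, hle y hy]
  have h1 : ∫ y in (0 : ℝ)..κ, floorBelow a κ A y = ∫ y in (0 : ℝ)..κ, A :=
    intervalIntegral.integral_congr_Ioo_of_le hκ fun y hy => by simp [floorBelow, hy.2.le]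
  have h2 : ∫ y in κ..w, floorBelow a κ A y = ∫ y in κ..w, a y :=
    intervalIntegral.integral_congr_Ioo_of_le hw.le fun y hy => h y hy.1
  rw [envelopePayment_eq hm, h w hw, ← intervalIntegral.integral_add_adjacent_intervals
    (b := κ) hm.intervalIntegrable hm.intervalIntegrable, h1, h2]
  simp
  ring

end

namespace Mechanism

variable {β b : ℝ} {M : Mechanism β} {f : ℝ × ℝ → ℝ}

/-- A mechanism in which no principal ever wants to exceed the budget is a mechanism for the
agent alone. -/
theorem rev_le_of_agent_only (hβ : 0 ≤ β) (hb : 0 ≤ b) (hf : IsPrior β f) (hIC : M.IC b)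
    (hIR : M.IR) (hrev : M.HasRevenue f)
    (hD : ∀ w ∈ Icc 0 β, ∀ z ∈ choice M.range w, z.2 ≤ b) {c g : ℝ} (hc : 0 ≤ c) (hg : 0 ≤ g)
    (hcg : ∀ x ∈ Icc 0 β, x * tail f Prod.fst x ≤ c + g * x) :
    M.rev f ≤ c * demand (budgetSet b M.range) β + g * b +
      (1 - demand (budgetSet b M.range) β) * (β * tail f Prod.snd β) := by
  have hX := isMenu_range hb hIC hIR
  have hY := isMenu_budgetSet hb hIC hIR
  set Y := budgetSet b M.range with hYdef
  -- The constant second rule collects nothing, and the threshold `β` leaves `β` as the only price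
  -- at which the principal's revenue must be bounded.
  refine hf.rev_le hrev (fun v hv => hX.pay _ ⟨v, hv, rfl⟩) hY.monotone_demand
    (monotone_const (c := demand Y β)) (κ := β) le_rfl
    (fun y hy => ⟨hY.demand_nonneg y, hY.monotone_demand hy.2⟩)
    (fun y _ => ⟨le_rfl, hY.demand_le_one β⟩) (fun _ _ => le_rfl) ?_ (ae_of_all _ fun v hv => ?_)
    (fun x hx hx' => by rw [le_antisymm hx.2 hx']) (mul_nonneg hβ (hf.tail_nonneg _ _)) hβ hc hg
    hcg
  · have h := hY.envelopePayment_demand β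
    rw [envelopePayment] at h
    rw [h]
    have := hY.mul_demand_le (b := b) (fun z hz => hz.2) hβ
    linarith
  · rw [hY.envelopePayment_demand]
    have h0 : envelopePayment (fun _ => demand Y β) v.2 = 0 := by simp [envelopePayment]
    rw [h0, add_zero]
    rcases mem_pairChoice_cases (hIC v hv) with h | ⟨⟨z, hz, hlt⟩, -⟩
    · exact hY.pay_le_of_mem_choice hv.1.1 h
    · exact absurd (hD _ hv.2.1 z hz) (not_le.2 hlt)

/-- Revenue bound for a mechanism in which principals with values just above `κ`, but none with a
value below `κ`, pay more than the budget. -/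
theorem rev_le_of_threshold (hβ : 0 ≤ β) (hb : 0 ≤ b) (hf : IsPrior β f) (hIC : M.IC b)
    (hIR : M.IR) (hrev : M.HasRevenue f) {κ : ℝ}
    (hD : IsGLB {w | w ∈ Icc 0 β ∧ ∃ z ∈ choice M.range w, b < z.2} κ)
    (hne : {w | w ∈ Icc 0 β ∧ ∃ z ∈ choice M.range w, b < z.2}.Nonempty) :
    ∃ A ∈ Icc (0 : ℝ) 1, ∃ s ∈ Icc 0 β, b ≤ A * s ∧
      ∀ c g : ℝ, 0 ≤ c → 0 ≤ g → (∀ x ∈ Icc 0 β, x * tail f Prod.fst x ≤ c + g * x) →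
        M.rev f ≤ c * A + g * b + (1 - A) * (s * tail f Prod.snd s) := by
  have hX := isMenu_range hb hIC hIR
  have hY := isMenu_budgetSet hb hIC hIR
  set X := M.range with hXdef
  set Y := budgetSet b X with hYdef
  have hκ0 : 0 ≤ κ := hD.2 fun w hw => hw.1.1
  have hκβ : κ ≤ β := by
    obtain ⟨w, hw⟩ := hne
    exact (hD.1 hw).trans hw.1.2
  have hUu : ∀ w, indirectUtility Y w ≤ indirectUtility X w := fun w =>
    hY.indirectUtility_le fun z hz => hX.payoff_le hz.1
  have hB0 : 0 ≤ b + indirectUtility Y κ := add_nonneg hb (hY.indirectUtility_nonneg κ)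
  -- Principals `w₀` close to `κ` pay more than `b` and still get at least `U_Y(κ)`, so `w₀ * demand
  -- X w > b + U_Y(κ)`. The claim follows as `w₀` approaches `κ`.
  have hup : ∀ w, κ < w → b + indirectUtility Y κ ≤ κ * demand X w := by
    intro w hw
    by_contra! hlt
    obtain ⟨w₀, ⟨hw₀, z, hz, hbz⟩, hκw₀, hlt₀⟩ := hD.exists_between
      (lt_min hw (lt_add_of_pos_right κ (sub_pos.2 hlt)))
    have h1 := hX.payoff_eq_of_mem_choice hz
    have h2 := hX.le_demand_of_mem_choice hz
    have h3 := hX.monotone_demand (hlt₀.le.trans (min_le_left _ _))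
    have h4 := hX.monotone_indirectUtility hκw₀
    have h5 := hUu κ
    have h6 : w₀ * z.1 ≤ w₀ * demand X w := mul_le_mul_of_nonneg_left (h2.trans h3) hw₀.1
    have h7 : (w₀ - κ) * demand X w ≤ (w₀ - κ) * 1 :=
      mul_le_mul_of_nonneg_left (hX.demand_le_one w) (sub_nonneg.2 hκw₀)
    have h8 := hlt₀.trans_le (min_le_right _ _)
    unfold payoff at h1
    linarith
  -- `A` is the probability that leaves value `κ` with utility `U_Y(κ)` at price `b`. For `κ = 0`
  -- division gives `A = 0`, and `hup` forces the numerator to vanish as well.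
  set A : ℝ := (b + indirectUtility Y κ) / κ with hAdef
  have hκA : κ * A = b + indirectUtility Y κ := by
    rcases hκ0.eq_or_lt with h | h
    · have := hup (κ + 1) (by linarith)
      rw [← h] at this hB0 ⊢
      linarith
    · rw [hAdef]; field_simp
  have hA0 : 0 ≤ A := div_nonneg hB0 hκ0
  have hAX : ∀ w, κ < w → A ≤ demand X w := by
    intro w hw
    rcases hκ0.eq_or_lt with h | h
    · rw [hAdef, ← h, div_zero]
      exact hX.demand_nonneg w
    · rw [hAdef, div_le_iff₀ h, mul_comm]
      exact hup w hw
  have hA1 : A ≤ 1 := (hAX (κ + 1) (by linarith)).trans (hX.demand_le_one _)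
  -- Sum of the budget bound `w * demand ≤ U_Y(w) + b` and the convexity bound on `[w, κ]`.
  have hYA : ∀ w ∈ Ico 0 κ, demand Y w ≤ A := by
    intro w hw
    have h1 := hY.mul_demand_le (b := b) (fun z hz => hz.2) hw.1
    have h2 := hY.demand_mul_le w κ hw.2.le
    have h3 : 0 < κ := hw.1.trans_lt hw.2
    rw [hAdef, le_div_iff₀ h3]
    linarith
  obtain ⟨s, hs, hmax⟩ := isCompact_Icc.exists_isMaxOn (nonempty_Icc.2 hκβ)
    ((continuous_id.mul hf.continuous_tail_snd).continuousOn (s := Icc κ β))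
  have hmY := hY.monotone_demand
  have hmX := hX.monotone_demand
  have hpayb : κ * A - ∫ y in (0 : ℝ)..κ, demand Y y = b := by
    rw [hY.integral_demand, hY.indirectUtility_zero, hκA]
    ring
  refine ⟨A, ⟨hA0, hA1⟩, s, ⟨hκ0.trans hs.1, hs.2⟩, ?_, fun c g hc hg hcg => ?_⟩
  · have h1 := mul_le_mul_of_nonneg_left hs.1 hA0
    have h2 := hY.indirectUtility_nonneg κ
    linarith
  refine hf.rev_le hrev (fun v hv => hX.pay _ ⟨v, hv, rfl⟩)
      (monotone_capAbove (κ := κ) (A := A) hmY)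
    (monotone_floorBelow (κ := κ) (A := A) hmX) hκβ (fun y _ => ?_) (fun y _ => ?_)
    (fun y hy => by simp [floorBelow, hy.2.le]) ?_ ?_ (fun x hx hκx => hmax ⟨hκx, hx.2⟩)
    (mul_nonneg (hκ0.trans hs.1) (hf.tail_nonneg _ _)) hβ hc hg hcg
  · unfold capAbove
    split_ifs
    · exact ⟨le_min (hY.demand_nonneg y) hA0, min_le_right _ _⟩
    · exact ⟨hA0, le_rfl⟩
  · unfold floorBelow
    split_ifs
    · exact ⟨le_rfl, hA1⟩
    · exact ⟨le_max_left _ _, max_le hA1 (hX.demand_le_one y)⟩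
  · rw [integral_sub_capAbove hmY hYA hκ0 hκβ, hpayb]
  · filter_upwards [ae_snd_ne κ] with v hvκ hv
    rcases mem_pairChoice_cases (hIC v hv) with h | ⟨hz, h⟩
    · have h2 := envelopePayment_nonneg (monotone_floorBelow (κ := κ) (A := A) hmX) hv.2.1.1
      rcases lt_or_ge v.1 κ with hlt | hge
      · rw [envelopePayment_capAbove_of_lt hYA ⟨hv.1.1, hlt⟩, hY.envelopePayment_demand]
        have := hY.pay_le_of_mem_choice hv.1.1 h
        simp only at this
        linarith
      · rw [envelopePayment_capAbove_of_ge hmY hYA hκ0 hge, hpayb]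
        have := h.1.2
        simp only at this
        linarith
    -- The two payments add up to `v.2 * demand X v.2 - U_X(v.2) + U_X(κ) - U_Y(κ)`, and `U_Y ≤ U_X`
    -- since `Y ⊆ X`.
    · have hκv : κ < v.2 := lt_of_le_of_ne (hD.1 ⟨hv.2.1, hz⟩) (Ne.symm hvκ)
      rw [envelopePayment_capAbove_of_ge hmY hYA hκ0 (hκv.le.trans hv.2.2), hpayb,
        envelopePayment_floorBelow hmX hAX hκ0 hκv, hX.integral_demand, hκA]
      have h1 := hX.pay_le_of_mem_choice hv.2.1.1 h
      have h2 := hUu κ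
      simp only at h1
      linarith

/-- Every incentive compatible and individually rational mechanism earns at most what it would
earn by selling probability `A` to the agent, subject to the budget, and `1 - A` to the principal
at the price `s`. -/
theorem exists_rev_le (hβ : 0 ≤ β) (hb : 0 ≤ b) (hf : IsPrior β f) (hIC : M.IC b)
    (hIR : M.IR) (hrev : M.HasRevenue f) :
    ∃ A ∈ Icc (0 : ℝ) 1, ∃ s ∈ Icc 0 β, (b ≤ A * s ∨ s = β) ∧
      ∀ c g : ℝ, 0 ≤ c → 0 ≤ g → (∀ x ∈ Icc 0 β, x * tail f Prod.fst x ≤ c + g * x) →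
        M.rev f ≤ c * A + g * b + (1 - A) * (s * tail f Prod.snd s) := by
  by_cases hne : {w | w ∈ Icc 0 β ∧ ∃ z ∈ choice M.range w, b < z.2}.Nonempty
  · obtain ⟨A, hA, s, hs, hbs, h⟩ := rev_le_of_threshold hβ hb hf hIC hIR hrev
      (isGLB_csInf hne ⟨0, fun w hw => hw.1.1⟩) hne
    exact ⟨A, hA, s, hs, Or.inl hbs, h⟩
  · have hY := isMenu_budgetSet hb hIC hIR
    refine ⟨_, ⟨hY.demand_nonneg β, hY.demand_le_one β⟩, β, ⟨hβ, le_rfl⟩, Or.inr rfl,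
      fun c g hc hg hcg => rev_le_of_agent_only hβ hb hf hIC hIR hrev (fun w hw z hz => ?_)
        hc hg hcg⟩
    by_contra! hlt
    exact hne ⟨w, hw, z, hz, hlt⟩

end Mechanism

/-! ### Posted-price mechanisms -/

theorem pairChoice_eq_of_pay_le {b : ℝ} {X : Set (ℝ × ℝ)} {v : ℝ × ℝ}
    (h : ∀ z ∈ choice X v.2, z.2 ≤ b) : pairChoice b X v = choice (budgetSet b X) v.1 := by
  refine if_neg fun hs => ?_
  obtain ⟨z, hz, hlt⟩ := exists_gt_of_strictlyBetter hs
  exact absurd (h z hz) (not_le.2 hlt)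

theorem IsPrior.hasRevenue_and_rev_eq {β : ℝ} {f : ℝ × ℝ → ℝ} (hf : IsPrior β f)
    {M : Mechanism β} {S₁ S₂ : Set (ℝ × ℝ)} (h₁ : MeasurableSet S₁) (h₂ : MeasurableSet S₂)
    {c₁ c₂ : ℝ} (hp : ∀ v ∈ typeSpace β, M.p v = S₁.indicator (fun _ => c₁) v +
      S₂.indicator (fun _ => c₂) v) :
    M.HasRevenue f ∧ M.rev f = c₁ * (∫ v in S₁, f v) + c₂ * ∫ v in S₂, f v := by
  have hi₁ : Integrable (S₁.indicator fun v => c₁ * f v) :=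
    (hf.integrable.const_mul c₁).indicator h₁
  have hi₂ : Integrable (S₂.indicator fun v => c₂ * f v) :=
    (hf.integrable.const_mul c₂).indicator h₂
  have heq : ∀ v ∈ typeSpace β, M.p v * f v =
      S₁.indicator (fun v => c₁ * f v) v + S₂.indicator (fun v => c₂ * f v) v := by
    intro v hv
    rw [hp v hv]
    by_cases hv₁ : v ∈ S₁ <;> by_cases hv₂ : v ∈ S₂ <;> simp [hv₁, hv₂, add_mul]
  have hV := measurableSet_typeSpace β
  refine ⟨((hi₁.add hi₂).integrableOn (s := typeSpace β)).congr_fun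
    (fun v hv => (heq v hv).symm) hV, ?_⟩
  have h0 : ∀ v, v ∉ typeSpace β →
      S₁.indicator (fun v => c₁ * f v) v + S₂.indicator (fun v => c₂ * f v) v = 0 := by
    intro v hv
    simp [indicator, hf.eq_zero_of_notMem hv]
  rw [Mechanism.rev, setIntegral_congr_fun hV heq,
    setIntegral_eq_integral_of_forall_compl_eq_zero h0, integral_add hi₁ hi₂,
      integral_indicator h₁, integral_indicator h₂, integral_const_mul,
    integral_const_mul]

/-- The mechanism that posts the price `κ` to the agent. -/
noncomputable def post₁ (β κ : ℝ) : Mechanism β where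
  q v := if v.1 ≤ κ then 0 else 1
  p v := if v.1 ≤ κ then 0 else κ
  q_mem v _ := by split_ifs <;> simp

section
variable {β b κ : ℝ}

theorem post₁_outcome (v : ℝ × ℝ) :
    ((post₁ β κ).q v, (post₁ β κ).p v) = if v.1 ≤ κ then (0, 0) else (1, κ) := by
  simp only [post₁]
  split_ifs <;> rfl

theorem post₁_IR (hβ : 0 ≤ β) (hκ : 0 ≤ κ) : (post₁ β κ).IR :=
  ⟨(0, 0), ⟨⟨le_rfl, hβ⟩, ⟨le_rfl, hβ⟩, le_rfl⟩, by simp [post₁, hκ]⟩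

theorem post₁_IC (hκ : κ ∈ Icc 0 b) : (post₁ β κ).IC b := by
  have hrange : ∀ z ∈ (post₁ β κ).range, z = (0, 0) ∨ z = (1, κ) := by
    rintro _ ⟨v, -, rfl⟩
    simp only [post₁_outcome]
    split_ifs <;> simp
  have hpay : ∀ z ∈ (post₁ β κ).range, z.2 ≤ b := by
    intro z hz
    rcases hrange z hz with rfl | rfl
    · exact hκ.1.trans hκ.2
    · exact hκ.2
  intro v hv
  have hmem : ((post₁ β κ).q v, (post₁ β κ).p v) ∈ (post₁ β κ).range := ⟨v, hv, rfl⟩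
  rw [pairChoice_eq_of_pay_le fun z hz => hpay z hz.1]
  refine ⟨⟨hmem, hpay _ hmem⟩, fun z hz => ?_⟩
  rw [post₁_outcome]
  rcases hrange z hz.1 with rfl | rfl <;> split_ifs with h <;> simp [payoff] <;> linarith

theorem IsPrior.post₁_rev {f : ℝ × ℝ → ℝ} (hf : IsPrior β f) :
    (post₁ β κ).HasRevenue f ∧ (post₁ β κ).rev f = postedRevenue₁ f κ := by
  have := hf.hasRevenue_and_rev_eq (M := post₁ β κ) (S₁ := {v | κ < v.1}) (S₂ := ∅)
    (c₁ := κ) (c₂ := 0) (measurableSet_lt measurable_const measurable_fst) MeasurableSet.empty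
    (fun v _ => by
      by_cases h : v.1 ≤ κ
      · simp [post₁, h, not_lt.2 h]
      · simp [post₁, h, not_le.1 h])
  rw [setIntegral_gt_eq_tail ae_fst_ne] at this
  rw [hf.postedRevenue₁_eq]
  simpa using this

end

/-- The mechanism that sells a lottery with price `b` to the agents with value at least `κ₁`, and
the good to the principals with value above `κ₂`. -/
noncomputable def post₂ (β : ℝ) {b κ₁ : ℝ} (hb : 0 ≤ b) (hκ₁ : b ≤ κ₁) (κ₂ : ℝ) :
    Mechanism β where
  q v := if v.1 < κ₁ then 0 else if κ₂ < v.2 then 1 else b / κ₁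
  p v := if v.1 < κ₁ then 0 else if κ₂ < v.2 then b + κ₂ * (1 - b / κ₁) else b
  q_mem v _ := by
    split_ifs
    · simp
    · simp
    · exact ⟨div_nonneg hb (hb.trans hκ₁), div_le_one_of_le₀ hκ₁ (hb.trans hκ₁)⟩

section
variable {β b κ₁ κ₂ : ℝ} (hb : 0 ≤ b) (hκ₁ : b ≤ κ₁)

theorem post₂_outcome (v : ℝ × ℝ) :
    ((post₂ β hb hκ₁ κ₂).q v, (post₂ β hb hκ₁ κ₂).p v) =
      if v.1 < κ₁ then (0, 0)
      else if κ₂ < v.2 then (1, b + κ₂ * (1 - b / κ₁)) else (b / κ₁, b) := by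
  simp only [post₂]
  split_ifs <;> rfl

theorem post₂_IR (hβ : 0 ≤ β) (hpos : 0 < κ₁) : (post₂ β hb hκ₁ κ₂).IR :=
  ⟨(0, 0), ⟨⟨le_rfl, hβ⟩, ⟨le_rfl, hβ⟩, le_rfl⟩, by simp [post₂, hpos]⟩

theorem post₂_IC (hpos : 0 < κ₁) (hκ : κ₁ ≤ κ₂) (hκβ : κ₁ ≤ β) : (post₂ β hb hκ₁ κ₂).IC b := by
  set M := post₂ β hb hκ₁ κ₂ with hM
  set r := b / κ₁ with hr
  have hrb : b = r * κ₁ := by rw [hr]; field_simp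
  have hr0 : 0 ≤ r := div_nonneg hb hpos.le
  have hr1 : r ≤ 1 := div_le_one_of_le₀ hκ₁ hpos.le
  have hκ₂ : 0 < κ₂ := hpos.trans_le hκ
  have hrange : ∀ z ∈ M.range, z = (0, 0) ∨ z = (r, b) ∨ z = (1, b + κ₂ * (1 - r)) := by
    rintro _ ⟨v, -, rfl⟩
    simp only [hM, post₂_outcome]
    split_ifs <;> simp [hr]
  have hlot : (r, b) ∈ M.range := by
    -- An agent exactly at the cutoff with a principal of value `0` receives the lottery, so it is
    -- always on the menu.
    refine ⟨(κ₁, 0), ⟨⟨hpos.le, hκβ⟩, ⟨le_rfl, hpos.le.trans hκβ⟩, hpos.le⟩, ?_⟩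
    simp only [hM, post₂_outcome]
    simp [not_lt.2 hκ₂.le, hr]
  have p0 : ∀ w, payoff w (0, 0) = 0 := fun w => by simp [payoff]
  have p1 : ∀ w, payoff w (r, b) = r * (w - κ₁) := fun w => by
    simp only [payoff]; rw [mul_sub, ← hrb]; ring
  -- Full purchase amounts to a fraction `r` at unit price `κ₁` plus the remaining `1 - r` at unit
  -- price `κ₂`.
  have p2 : ∀ w, payoff w (1, b + κ₂ * (1 - r)) = r * (w - κ₁) + (1 - r) * (w - κ₂) := fun w => by
    simp only [payoff]; rw [mul_sub r, ← hrb]; ring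
  have hlotchoice : ∀ w, κ₁ ≤ w → r < 1 →
      (r, b) ∈ choice (budgetSet b M.range) w := by
    intro w hw hlt
    refine ⟨⟨hlot, le_rfl⟩, fun z hz => ?_⟩
    have h1 : 0 ≤ r * (w - κ₁) := mul_nonneg hr0 (sub_nonneg.2 hw)
    rcases hrange z hz.1 with rfl | rfl | rfl
    · rw [p0, p1]; exact h1
    · exact le_rfl
    · have h2 := hz.2
      have h3 : 0 < κ₂ * (1 - r) := mul_pos hκ₂ (sub_pos.2 hlt)
      simp only at h2
      linarith
  intro v hv
  have hmem : (M.q v, M.p v) ∈ M.range := ⟨v, hv, rfl⟩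
  -- If `r = 1`, the lottery is the full good at price `b`, the two paid outcomes coincide and no
  -- one exceeds the budget.
  rcases hr1.eq_or_lt with hr1 | hr1
  · have hpay : ∀ z ∈ M.range, z.2 ≤ b := by
      intro z hz
      rcases hrange z hz with rfl | rfl | rfl <;> simp [hr1, hb]
    rw [pairChoice_eq_of_pay_le fun z hz => hpay z hz.1]
    refine ⟨⟨hmem, hpay _ hmem⟩, fun z hz => ?_⟩
    have hz' := hrange z hz.1
    rw [hM, post₂_outcome, ← hr]
    rw [hr1] at hz' hrb ⊢
    have hv2 := hv.2.2
    rcases hz' with rfl | rfl | rfl <;> split_ifs <;> simp [payoff] at * <;> linarith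
  have h1r : 0 < 1 - r := sub_pos.2 hr1
  have hnot : ∀ w, w < κ₂ → ∀ z ∈ choice M.range w, z.2 ≤ b := by
    intro w hw z hz
    rcases hrange z hz.1 with rfl | rfl | rfl
    · exact hb
    · exact le_rfl
    · have h1 := hz.2 _ hlot
      rw [p1, p2] at h1
      have := mul_neg_of_pos_of_neg h1r (sub_neg.2 hw)
      linarith
  rw [hM, post₂_outcome, ← hM, ← hr]
  split_ifs with h1 h2
  · rw [pairChoice_eq_of_pay_le (hnot _ ((hv.2.2.trans_lt h1).trans_le hκ))]
    have h0 : ((0 : ℝ), (0 : ℝ)) ∈ M.range := post₂_IR hb hκ₁ (hpos.le.trans hκβ) hpos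
    refine ⟨⟨h0, hb⟩, fun z hz => ?_⟩
    have h3 : r * (v.1 - κ₁) ≤ 0 := mul_nonpos_of_nonneg_of_nonpos hr0 (sub_nonpos.2 h1.le)
    rw [p0]
    rcases hrange z hz.1 with rfl | rfl | rfl
    · rw [p0]
    · rwa [p1]
    · rw [p2]
      have := mul_neg_of_pos_of_neg h1r (sub_neg.2 (h1.trans_le hκ))
      linarith
  · have hv1 : κ₁ ≤ v.2 := hκ.trans h2.le
    have hmem' : (1, b + κ₂ * (1 - r)) ∈ M.range := by
      refine ⟨v, hv, ?_⟩
      simp only [hM, post₂_outcome]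
      rw [if_neg h1, if_pos h2, hr]
    have hgt : ∀ w, κ₂ < w → ∀ z ∈ M.range, z ≠ (1, b + κ₂ * (1 - r)) →
        payoff w z < payoff w (1, b + κ₂ * (1 - r)) := by
      intro w hw z hz hne
      have h3 : 0 ≤ r * (w - κ₁) := mul_nonneg hr0 (sub_nonneg.2 (hκ.trans hw.le))
      have h4 : 0 < (1 - r) * (w - κ₂) := mul_pos h1r (sub_pos.2 hw)
      rw [p2]
      rcases hrange z hz with rfl | rfl | rfl
      · rw [p0]; linarith
      · rw [p1]; linarith
      · exact absurd rfl hne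
    have hch : (1, b + κ₂ * (1 - r)) ∈ choice M.range v.2 := by
      refine ⟨hmem', fun z hz => ?_⟩
      by_cases hz' : z = (1, b + κ₂ * (1 - r))
      · rw [hz']
      · exact (hgt _ h2 z hz hz').le
    have hne : ∀ z ∈ budgetSet b M.range, z ≠ (1, b + κ₂ * (1 - r)) := by
      rintro z hz rfl
      have h3 := hz.2
      have h4 : 0 < κ₂ * (1 - r) := mul_pos hκ₂ h1r
      simp only at h3
      linarith
    have hstrict : StrictlyBetter v.1 (choice M.range v.2)
        (choice (budgetSet b M.range) v.1) := by
      have hv2 : κ₂ < v.1 := h2.trans_le hv.2.2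
      have hl := hlotchoice v.1 (not_lt.1 h1) hr1
      refine ⟨fun z hz z' hz' => ?_, _, hch, _, hl, hgt _ hv2 _ hlot (hne _ hl.1)⟩
      have : z = (1, b + κ₂ * (1 - r)) := by
        by_contra hzne
        exact absurd (hz.2 _ hmem') (not_le.2 (hgt _ h2 z hz.1 hzne))
      rw [this]
      exact (hgt _ hv2 z' hz'.1.1 (hne z' hz'.1)).le
    rw [pairChoice, if_pos hstrict]
    exact hch
  -- The principal can prevail here only at the tie `v.2 = κ₂`, where the lottery is optimal for her
  -- too.
  · by_cases hs : StrictlyBetter v.1 (choice M.range v.2) (choice (budgetSet b M.range) v.1)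
    · rw [pairChoice, if_pos hs]
      obtain ⟨z, hz, hlt⟩ := exists_gt_of_strictlyBetter hs
      have hκv : v.2 = κ₂ := by
        by_contra hne
        exact absurd (hnot _ (lt_of_le_of_ne (not_lt.1 h2) hne) z hz) (not_le.2 hlt)
      refine ⟨hlot, fun z' hz' => (hz.2 z' hz').trans ?_⟩
      rcases hrange z hz.1 with rfl | rfl | rfl
      · exact absurd hlt (not_lt.2 hb)
      · exact le_rfl
      · rw [p1, p2, hκv, sub_self, mul_zero, add_zero]
    · rw [pairChoice, if_neg hs]
      exact hlotchoice v.1 (not_lt.1 h1) hr1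

/-- Expected revenue of the mechanism `post₂`. -/
noncomputable def postedRevenue₂ (f : ℝ × ℝ → ℝ) (b κ₁ κ₂ : ℝ) : ℝ :=
  b * tail f Prod.fst κ₁ + κ₂ * (1 - b / κ₁) * tail f Prod.snd κ₂

/-- As `κ₁ ≤ κ₂` and `v₂ ≤ v₁`, everyone above `κ₂` also passes `κ₁`, so the payment is `b` plus a
surcharge on a nested event. -/
theorem IsPrior.post₂_rev {f : ℝ × ℝ → ℝ} (hf : IsPrior β f) (hκ : κ₁ ≤ κ₂) :
    (post₂ β hb hκ₁ κ₂).HasRevenue f ∧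
      (post₂ β hb hκ₁ κ₂).rev f = postedRevenue₂ f b κ₁ κ₂ := by
  have := hf.hasRevenue_and_rev_eq (M := post₂ β hb hκ₁ κ₂) (S₁ := {v | κ₁ ≤ v.1})
    (S₂ := {v | κ₂ < v.2}) (c₁ := b) (c₂ := κ₂ * (1 - b / κ₁))
    (measurableSet_le measurable_const measurable_fst)
    (measurableSet_lt measurable_const measurable_snd)
    (fun v hv => by
      have hv2 := hv.2.2
      by_cases h1 : v.1 < κ₁
      · have h2 : ¬ κ₂ < v.2 := not_lt.2 ((hv2.trans h1.le).trans hκ)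
        simp [post₂, h1, h2]
      · by_cases h2 : κ₂ < v.2 <;> simp [post₂, h1, h2, not_lt.1 h1])
  rw [setIntegral_gt_eq_tail ae_snd_ne] at this
  exact this

end

/-! ### Optimality -/

/-- The right tangent of a concave function lies above its graph; it cannot slope down at `x₀`,
because a maximizer lies to the right. -/
theorem exists_nonneg_slope_of_concaveOn {G : ℝ → ℝ} {β k x₀ : ℝ}
    (hG : ConcaveOn ℝ (Icc 0 β) G) (hk : k ∈ Icc 0 β) (hmax : IsMaxOn G (Icc 0 β) k)
    (h0 : 0 < x₀) (hx₀ : x₀ < k) :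
    ∃ g, 0 ≤ g ∧ ∀ x ∈ Icc 0 β, G x ≤ G x₀ + g * (x - x₀) := by
  have hInt : x₀ ∈ interior (Icc 0 β) := by
    rw [interior_Icc]
    exact ⟨h0, hx₀.trans_le hk.2⟩
  have hmem : x₀ ∈ Icc 0 β := interior_subset hInt
  have hc := hG.neg
  set d := derivWithin (-G) (Ioi x₀) x₀ with hd
  have hright : ∀ y ∈ Icc 0 β, x₀ < y → G y ≤ G x₀ + -d * (y - x₀) := by
    intro y hy hlt
    have := hc.rightDeriv_le_slope_of_mem_interior hInt hy hlt
    rw [slope_def_field, le_div_iff₀ (sub_pos.2 hlt)] at this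
    simp only [Pi.neg_apply] at this
    linarith
  refine ⟨-d, ?_, fun x hx => ?_⟩
  · have h1 := hright k hk hx₀
    have h2 := hmax hmem
    have h3 : 0 < k - x₀ := sub_pos.2 hx₀
    simp only [mem_ofPred_eq] at h2
    by_contra! hneg
    have := mul_neg_of_neg_of_pos hneg h3
    linarith
  · rcases lt_trichotomy x x₀ with hlt | rfl | hlt
    · have h1 := hc.slope_le_leftDeriv_of_mem_interior hx hInt hlt
      have h2 := h1.trans (hc.leftDeriv_le_rightDeriv_of_mem_interior hInt)
      rw [slope_def_field, div_le_iff₀ (sub_pos.2 hlt)] at h2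
      simp only [Pi.neg_apply] at h2
      linarith
    · simp
    · exact hright x hx hlt

namespace IsPrior

variable {β b : ℝ} {f : ℝ × ℝ → ℝ}

theorem snd_revenue_le (hf : IsPrior β f) {x : ℝ} (hx : 0 ≤ x) :
    x * tail f Prod.snd x ≤ postedRevenue₁ f x := by
  rw [hf.postedRevenue₁_eq]
  exact mul_le_mul_of_nonneg_left (hf.tail_snd_le_tail_fst x) hx

theorem postedRevenue₂_eq (hf : IsPrior β f) {κ₁ : ℝ} (h : 0 < κ₁) (κ₂ : ℝ) :
    postedRevenue₂ f b κ₁ κ₂ = b / κ₁ * postedRevenue₁ f κ₁ +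
      (1 - b / κ₁) * (κ₂ * tail f Prod.snd κ₂) := by
  rw [hf.postedRevenue₁_eq, postedRevenue₂]
  field_simp

/-- Some prices maximize the revenue of `post₂`. -/
theorem exists_isMaxOn_postedRevenue₂ (hf : IsPrior β f) (hβ : 0 < β) (hb : 0 ≤ b) (hbβ : b ≤ β) :
    ∃ κ₁ κ₂, b ≤ κ₁ ∧ 0 < κ₁ ∧ κ₁ ≤ κ₂ ∧ κ₂ ≤ β ∧
      ∀ x y, b ≤ x → 0 < x → x ≤ y → y ≤ β →
        postedRevenue₂ f b x y ≤ postedRevenue₂ f b κ₁ κ₂ := by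
  -- For `b = 0` the requirement `0 < κ₁` spoils compactness, but the revenue no longer depends on
  -- `κ₁`.
  rcases hb.eq_or_lt with rfl | hb
  · obtain ⟨s, hs, hmax⟩ := isCompact_Icc.exists_isMaxOn (nonempty_Icc.2 hβ.le)
      ((continuous_id.mul hf.continuous_tail_snd).continuousOn (s := Icc 0 β))
    have hval : ∀ x y, postedRevenue₂ f 0 x y = y * tail f Prod.snd y := fun x y => by
      simp [postedRevenue₂]
    have hmax' : ∀ y ∈ Icc 0 β, y * tail f Prod.snd y ≤ s * tail f Prod.snd s :=
      fun y hy => hmax hy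
    rcases hs.1.eq_or_lt with h | h
    · refine ⟨β, β, hβ.le, hβ, le_rfl, le_rfl, fun x y _ hx hxy hy => ?_⟩
      rw [hval, hval]
      refine (hmax' y ⟨hx.le.trans hxy, hy⟩).trans ?_
      rw [← h, zero_mul]
      exact mul_nonneg hβ.le (hf.tail_nonneg _ _)
    · refine ⟨s, s, h.le, h, le_rfl, hs.2, fun x y _ hx hxy hy => ?_⟩
      rw [hval, hval]
      exact hmax' y ⟨hx.le.trans hxy, hy⟩
  · have hcompact : IsCompact ((Icc b β ×ˢ Icc b β) ∩ {x : ℝ × ℝ | x.1 ≤ x.2}) :=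
      (isCompact_Icc.prod isCompact_Icc).inter_right (isClosed_le continuous_fst continuous_snd)
    have hcont : ContinuousOn (fun x : ℝ × ℝ => postedRevenue₂ f b x.1 x.2)
        ((Icc b β ×ˢ Icc b β) ∩ {x : ℝ × ℝ | x.1 ≤ x.2}) := by
      have h1 : ContinuousOn (fun x : ℝ × ℝ => b / x.1)
          ((Icc b β ×ˢ Icc b β) ∩ {x : ℝ × ℝ | x.1 ≤ x.2}) :=
        continuousOn_const.div continuousOn_fst fun x hx => (hb.trans_le hx.1.1.1).ne'
      have h2 := hf.continuous_tail_fst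
      have h3 := hf.continuous_tail_snd
      unfold postedRevenue₂
      fun_prop
    obtain ⟨⟨κ₁, κ₂⟩, hκ, hmax⟩ := hcompact.exists_isMaxOn
      ⟨(β, β), ⟨⟨⟨hbβ, le_rfl⟩, hbβ, le_rfl⟩, le_refl β⟩⟩ hcont
    refine ⟨κ₁, κ₂, hκ.1.1.1, hb.trans_le hκ.1.1.1, hκ.2, hκ.1.2.2, fun x y hx _ hxy hy => ?_⟩
    exact hmax (a := (x, y)) ⟨⟨⟨hx, hxy.trans hy⟩, hx.trans hxy, hy⟩, hxy⟩

/-- Every mechanism is dominated by some `post₂`, if the budget is below the monopoly price. -/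
theorem exists_rev_le_postedRevenue₂ (hf : IsPrior β f) (hb : 0 ≤ b)
    (hconc : ConcaveOn ℝ (Icc 0 β) (postedRevenue₁ f)) {k : ℝ} (hk : k ∈ Icc 0 β)
    (hmax : IsMaxOn (postedRevenue₁ f) (Icc 0 β) k) (hbk : b < k) {M : Mechanism β}
    (hIC : M.IC b) (hIR : M.IR) (hrev : M.HasRevenue f) :
    ∃ κ₁ κ₂, b ≤ κ₁ ∧ 0 < κ₁ ∧ κ₁ ≤ κ₂ ∧ κ₂ ≤ β ∧ M.rev f ≤ postedRevenue₂ f b κ₁ κ₂ := by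
  have hk0 : 0 < k := hb.trans_lt hbk
  obtain ⟨A, hA, s, hs, hAs, hbound⟩ :=
    Mechanism.exists_rev_le (hk.1.trans hk.2) hb hf hIC hIR hrev
  have hR0 : 0 ≤ s * tail f Prod.snd s := mul_nonneg hs.1 (hf.tail_nonneg _ _)
  have hmax' : ∀ x ∈ Icc 0 β, postedRevenue₁ f x ≤ postedRevenue₁ f k := fun x hx => hmax hx
  rcases hb.eq_or_lt with rfl | hb
  -- With no budget the multiplier costs nothing, so the crude line `x` suffices.
  · have h := hbound 0 1 le_rfl zero_le_one fun x hx => by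
      have := mul_le_mul_of_nonneg_left (hf.tail_le_one Prod.fst x) hx.1
      linarith
    have h' : M.rev f ≤ s * tail f Prod.snd s := by
      have := mul_nonneg hA.1 hR0
      linarith
    rcases hs.1.eq_or_lt with h0 | h0
    · refine ⟨k, k, hk.1, hk0, le_rfl, hk.2, ?_⟩
      rw [← h0, zero_mul] at h'
      have := mul_nonneg hk.1 (hf.tail_nonneg Prod.snd k)
      simp only [postedRevenue₂, zero_mul, zero_div, sub_zero, mul_one, zero_add]
      linarith
    · refine ⟨s, s, hs.1, h0, le_rfl, hs.2, ?_⟩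
      simpa [postedRevenue₂] using h'
  -- If `A k ≤ b`, the flat line is used and `A` is raised to `b / k`: this moves probability to the
  -- agent, whose monopoly revenue is at least what the principal yields.
  · rcases le_or_gt (A * k) b with hAk | hAk
    · have h := hbound (postedRevenue₁ f k) 0
        (by rw [hf.postedRevenue₁_eq]; exact mul_nonneg hk.1 (hf.tail_nonneg _ _)) le_rfl
        fun x hx => by
          rw [← hf.postedRevenue₁_eq]
          simpa using hmax' x hx
      have hks : k ≤ s := by
        rcases hAs with hAs | rfl
        · by_contra! hlt
          rcases hA.1.eq_or_lt with h0 | h0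
          · rw [← h0] at hAs
            linarith
          · have := mul_lt_mul_of_pos_left hlt h0
            linarith
        · exact hk.2
      refine ⟨k, s, hbk.le, hk0, hks, hs.2, ?_⟩
      rw [hf.postedRevenue₂_eq hk0]
      have h1 : A ≤ b / k := (le_div_iff₀ hk0).2 hAk
      have h2 := (hf.snd_revenue_le hs.1).trans (hmax' s hs)
      have h3 := mul_le_mul_of_nonneg_right h1 (sub_nonneg.2 h2)
      linarith
    · have hA0 : 0 < A := by
        by_contra! hle
        have := mul_nonpos_of_nonpos_of_nonneg hle hk.1
        linarith
      have hx0 : 0 < b / A := div_pos hb hA0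
      have hxk : b / A < k := by rwa [div_lt_iff₀ hA0, mul_comm]
      have hxmem : b / A ∈ Icc 0 β := ⟨hx0.le, hxk.le.trans hk.2⟩
      -- Tangent at the price `b / A` for which a lottery of probability `A` costs exactly `b`; the
      -- terms in `g` then cancel. Its intercept is nonnegative because posted revenue vanishes at
      -- `0`.
      obtain ⟨g, hg, htan⟩ := exists_nonneg_slope_of_concaveOn hconc hk hmax hx0 hxk
      have hc : 0 ≤ postedRevenue₁ f (b / A) - g * (b / A) := by
        have h := htan 0 ⟨le_rfl, hk.1.trans hk.2⟩
        have h0 : postedRevenue₁ f 0 = 0 := by simp [postedRevenue₁]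
        rw [h0] at h
        linarith
      have h := hbound _ g hc hg fun x hx => by
        rw [← hf.postedRevenue₁_eq]
        have := htan x hx
        linarith
      have hxA : b / A * A = b := div_mul_cancel₀ b hA0.ne'
      have hinv : b / (b / A) = A := by field_simp
      refine ⟨b / A, s, ?_, hx0, ?_, hs.2, ?_⟩
      · rw [le_div_iff₀ hA0]
        have := mul_le_mul_of_nonneg_left hA.2 hb.le
        linarith
      · rcases hAs with hAs | rfl
        · rwa [div_le_iff₀ hA0, mul_comm]
        · exact hxmem.2
      · rw [hf.postedRevenue₂_eq hx0, hinv]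
        refine h.trans (le_of_eq ?_)
        linear_combination (-g) * hxA

/-- No mechanism earns more than the monopoly revenue from an agent without a budget. -/
theorem rev_le_postedRevenue₁ (hf : IsPrior β f) (hb : 0 ≤ b) {k : ℝ} (hk : k ∈ Icc 0 β)
    (hmax : IsMaxOn (postedRevenue₁ f) (Icc 0 β) k) {M : Mechanism β}
    (hIC : M.IC b) (hIR : M.IR) (hrev : M.HasRevenue f) : M.rev f ≤ postedRevenue₁ f k := by
  obtain ⟨A, hA, s, hs, -, hbound⟩ :=
    Mechanism.exists_rev_le (hk.1.trans hk.2) hb hf hIC hIR hrev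
  have hmax' : ∀ x ∈ Icc 0 β, postedRevenue₁ f x ≤ postedRevenue₁ f k := fun x hx => hmax hx
  have h := hbound (postedRevenue₁ f k) 0
    (by rw [hf.postedRevenue₁_eq]; exact mul_nonneg hk.1 (hf.tail_nonneg _ _)) le_rfl
    fun x hx => by
      rw [← hf.postedRevenue₁_eq]
      simpa using hmax' x hx
  have h2 := (hf.snd_revenue_le hs.1).trans (hmax' s hs)
  have h3 := mul_le_mul_of_nonneg_left h2 (sub_nonneg.2 hA.2)
  linarith

end IsPrior

end PrincipalAgent

theorem mainTheorem2 (β b : ℝ) (hβ : 0 < β) (hb : 0 ≤ b) (f : ℝ × ℝ → ℝ)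
    (hf : PrincipalAgent.IsPrior β f)
    (hconc : StrictConcaveOn ℝ (Set.Icc 0 β) (PrincipalAgent.postedRevenue₁ f))
    (κ : ℝ) (hκ : κ ∈ Set.Icc 0 β)
    (hmax : IsMaxOn (PrincipalAgent.postedRevenue₁ f) (Set.Icc 0 β) κ) :
    (b < κ → ∃ M : PrincipalAgent.Mechanism β, M.IsPost2 b ∧ M.IsOptimal b f) ∧
    (κ ≤ b → ∃ M : PrincipalAgent.Mechanism β, M.IsPost1 b ∧ M.IsOptimal b f) := by
  open PrincipalAgent in
  refine ⟨fun hbκ => ?_, fun hκb => ?_⟩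
  · obtain ⟨κ₁, κ₂, h1, hpos, h12, h2, hopt⟩ :=
      hf.exists_isMaxOn_postedRevenue₂ hβ hb (hbκ.le.trans hκ.2)
    obtain ⟨hInt, hrev⟩ := hf.post₂_rev hb h1 h12
    refine ⟨post₂ β hb h1 κ₂, ⟨κ₁, ⟨h1, h12.trans h2⟩, κ₂, ⟨h1.trans h12, h2⟩, hpos, h12,
      fun v _ => post₂_outcome hb h1 v⟩, post₂_IC hb h1 hpos h12 (h12.trans h2),
      post₂_IR hb h1 hβ.le hpos, hInt, fun M hIC hIR hM => ?_⟩
    obtain ⟨x, y, hx, hx0, hxy, hy, hle⟩ :=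
      hf.exists_rev_le_postedRevenue₂ hb hconc.concaveOn hκ hmax hbκ hIC hIR hM
    rw [hrev]
    exact hle.trans (hopt x y hx hx0 hxy hy)
  · obtain ⟨hInt, hrev⟩ := hf.post₁_rev (κ := κ)
    refine ⟨post₁ β κ, ⟨κ, ⟨hκ.1, hκb⟩, fun v _ => post₁_outcome v⟩, post₁_IC ⟨hκ.1, hκb⟩,
      post₁_IR hβ.le hκ.1, hInt, fun M hIC hIR hM => ?_⟩
    rw [hrev]
    exact hf.rev_le_postedRevenue₁ hb hκ hmax hIC hIR hM
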